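/- Let $\pi : M \to \Theta$ be a smooth ($C^\infty$) fibre bundle with typical fibre $X$, where $M$, $\Theta$ and $X$ are compact finite-dimensional smooth manifolds (Hausdorff, without boundary), and let $f : M \to \mathbb{R}$ be smooth. A point $p \in M$ is called a fibre-wise critical point of $f$ if it is a critical point of the restriction $f|_{\pi^{-1}(\pi(p))}$ of $f$ to the fibre containing $p$; it is called non-degenerate if the Hessian of this restriction at $p$ is non-singular; and $p$ is called a fibre-wise local minimum of $f$ if it is a local minimum of this restriction. Assume that $f$ is fibre-wise Morse, that is, every fibre-wise critical point of $f$ is non-degenerate, and let $N \subset M$ be the set of all fibre-wise critical points of $f$, with the subspace topology. If $p$ and $q$ lie on the same connected component of $N$, then $p$ is a fibre-wise local minimum of $f$ if and only if $q$ is a fibre-wise local minimum of $f$. -/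

import Mathlib

open scoped Manifold ContDiff Topology

noncomputable section

namespace FibreOpt

variable {EM HM M EΘ HΘ Θ EX HX X : Type*}
  [NormedAddCommGroup EM] [NormedSpace ℝ EM] [TopologicalSpace HM]
  [TopologicalSpace M] [ChartedSpace HM M]
  [NormedAddCommGroup EΘ] [NormedSpace ℝ EΘ] [TopologicalSpace HΘ]
  [TopologicalSpace Θ] [ChartedSpace HΘ Θ]
  [NormedAddCommGroup EX] [NormedSpace ℝ EX] [TopologicalSpace HX]
  [TopologicalSpace X] [ChartedSpace HX X]

/-- A local trivialization `π⁻¹(U) ≃ U × X` over an open set `U = e.baseSet` is smooth if it is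
a `C^∞`-diffeomorphism. -/
structure IsSmoothTrivialization (IM : ModelWithCorners ℝ EM HM) (IΘ : ModelWithCorners ℝ EΘ HΘ)
    (IX : ModelWithCorners ℝ EX HX) {π : M → Θ} (e : Bundle.Trivialization X π) : Prop where
  contMDiffOn_toFun : ContMDiffOn IM (IΘ.prod IX) ∞ e e.source
  contMDiffOn_symm : ContMDiffOn (IΘ.prod IX) IM ∞ e.toOpenPartialHomeomorph.symm e.target

/-- `π : M → Θ` is a smooth fibre bundle with typical fibre `X`: every point of the base has an
open neighbourhood over which there is a smooth local trivialization. -/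
def IsSmoothFibreBundle (IM : ModelWithCorners ℝ EM HM) (IΘ : ModelWithCorners ℝ EΘ HΘ)
    (IX : ModelWithCorners ℝ EX HX) (X : Type*)
    [TopologicalSpace X] [ChartedSpace HX X] (π : M → Θ) : Prop :=
  ∀ θ : Θ, ∃ e : Bundle.Trivialization X π, IsSmoothTrivialization IM IΘ IX e ∧ θ ∈ e.baseSet

/-- A smooth local trivialization `e` over a neighbourhood of `π p`, together with a smooth chart
`φ` of the typical fibre around the point corresponding to `p`. Such a pair gives the smooth chart
`y ↦ φ (e y).2` around `p` of the fibre `π⁻¹(π p)`. -/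
structure IsFibreChartAt (IM : ModelWithCorners ℝ EM HM) (IΘ : ModelWithCorners ℝ EΘ HΘ)
    (IX : ModelWithCorners ℝ EX HX) {π : M → Θ} (e : Bundle.Trivialization X π)
    (φ : OpenPartialHomeomorph X HX) (p : M) : Prop where
  smooth_triv : IsSmoothTrivialization IM IΘ IX e
  mem_baseSet : π p ∈ e.baseSet
  mem_atlas : φ ∈ IsManifold.maximalAtlas IX ∞ X
  mem_source : (e p).2 ∈ φ.source

/-- The restriction of `f` to the fibre `π⁻¹(θ)`, written in the fibre chart given by `e`, `φ`. -/
def fibreRep (IX : ModelWithCorners ℝ EX HX) {π : M → Θ} (e : Bundle.Trivialization X π)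
    (φ : OpenPartialHomeomorph X HX) (f : M → ℝ) (θ : Θ) : EX → ℝ :=
  fun v => f (e.toOpenPartialHomeomorph.symm (θ, (φ.extend IX).symm v))

/-- The coordinates of `p` in the fibre chart given by `e`, `φ`. -/
def fibreCoord (IX : ModelWithCorners ℝ EX HX) {π : M → Θ} (e : Bundle.Trivialization X π)
    (φ : OpenPartialHomeomorph X HX) (p : M) : EX :=
  φ.extend IX (e p).2

/-- The Hessian at `p` of the restriction of `f` to the fibre through `p`, in the fibre chart given
by `e`, `φ`: the second derivative of the coordinate representation, as a bilinear form. -/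
def fibreHessian (IX : ModelWithCorners ℝ EX HX) {π : M → Θ} (e : Bundle.Trivialization X π)
    (φ : OpenPartialHomeomorph X HX) (f : M → ℝ) (p : M) : EX →L[ℝ] EX →L[ℝ] ℝ :=
  fderiv ℝ (fderiv ℝ (fibreRep IX e φ f (π p))) (fibreCoord IX e φ p)

/-- `p` is a critical point of the restriction of the smooth function `f` to the fibre `π⁻¹(π p)`:
the differential of the restriction vanishes at `p`, in fibre charts. (By the chain rule it
vanishes in one fibre chart iff it vanishes in all of them.) -/
def IsFibrewiseCriticalPoint (IM : ModelWithCorners ℝ EM HM) (IΘ : ModelWithCorners ℝ EΘ HΘ)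
    (IX : ModelWithCorners ℝ EX HX) (X : Type*)
    [TopologicalSpace X] [ChartedSpace HX X] (π : M → Θ) (f : M → ℝ) (p : M) : Prop :=
  ∀ (e : Bundle.Trivialization X π) (φ : OpenPartialHomeomorph X HX),
    IsFibreChartAt IM IΘ IX e φ p →
      fderiv ℝ (fibreRep IX e φ f (π p)) (fibreCoord IX e φ p) = 0

/-- The Hessian at `p` of the restriction of `f` to the fibre `π⁻¹(π p)` is non-singular. (At a
fibre-wise critical point of a smooth function this does not depend on the fibre chart.) -/
def FibrewiseHessianNonsingular (IM : ModelWithCorners ℝ EM HM)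
    (IΘ : ModelWithCorners ℝ EΘ HΘ) (IX : ModelWithCorners ℝ EX HX) (X : Type*)
    [TopologicalSpace X] [ChartedSpace HX X] (π : M → Θ) (f : M → ℝ)
    (p : M) : Prop :=
  ∀ (e : Bundle.Trivialization X π) (φ : OpenPartialHomeomorph X HX),
    IsFibreChartAt IM IΘ IX e φ p →
      ∀ v : EX, (∀ w : EX, fibreHessian IX e φ f p v w = 0) → v = 0

/-- The set `N` of fibre-wise critical points of `f`. -/
def fibrewiseCriticalSet (IM : ModelWithCorners ℝ EM HM) (IΘ : ModelWithCorners ℝ EΘ HΘ)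
    (IX : ModelWithCorners ℝ EX HX) (X : Type*)
    [TopologicalSpace X] [ChartedSpace HX X] (π : M → Θ) (f : M → ℝ) : Set M :=
  {p | IsFibrewiseCriticalPoint IM IΘ IX X π f p}

/-- A fibre-wise Morse function: all fibre-wise critical points are non-degenerate. -/
def IsFibrewiseMorse (IM : ModelWithCorners ℝ EM HM) (IΘ : ModelWithCorners ℝ EΘ HΘ)
    (IX : ModelWithCorners ℝ EX HX) (X : Type*)
    [TopologicalSpace X] [ChartedSpace HX X] (π : M → Θ) (f : M → ℝ) : Prop :=
  ∀ p : M, IsFibrewiseCriticalPoint IM IΘ IX X π f p → FibrewiseHessianNonsingular IM IΘ IX X π f p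

/-- `p` is a local minimum of the restriction of `f` to the fibre `π⁻¹(π p)`. -/
def IsFibrewiseLocalMin (π : M → Θ) (f : M → ℝ) (p : M) : Prop :=
  IsLocalMinOn f (π ⁻¹' {π p}) p

end FibreOpt

end

/-! ### Second-order conditions and definiteness of bilinear forms. -/

section SecondOrder

open Filter

variable {E : Type*} [NormedAddCommGroup E] [NormedSpace ℝ E]

/-! At a non-degenerate fibre-wise critical point, minimality is equivalent to positive definiteness
of the fibre Hessian (`isLocalMin_iff_fderiv_fderiv_pos`). A single fibre chart serves all points
near a given one, and in it the Hessian varies continuously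
(`IsFibreChartAt.continuousAt_fibreHessian`). Positive definiteness persists under small
perturbations; so does its failure at a nonsingular symmetric form, since such a form takes a
negative value on some vector. Hence being a minimum is locally constant on the critical set, and
therefore constant on its connected components. -/

/-- The derivative of a function along a line. -/
theorem HasFDerivAt.hasDerivAt_comp_add_smul {F : Type*} [NormedAddCommGroup F] [NormedSpace ℝ F]
    {g : E → F} {g' : E →L[ℝ] F} {x v : E} {t : ℝ} (h : HasFDerivAt g g' (x + t • v)) :
    HasDerivAt (fun s : ℝ => g (x + s • v)) (g' v) t := by
  have h1 : HasDerivAt (fun s : ℝ => x + s • v) v t := by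
    simpa using ((hasDerivAt_id t).smul_const v).const_add x
  exact h.comp_hasDerivAt t h1

/-- Second-order necessary condition for a local minimum. -/
theorem IsLocalMin.fderiv_fderiv_apply_self_nonneg {g : E → ℝ} {x : E} (h : IsLocalMin g x)
    (hg : ContDiffAt ℝ 2 g x) (v : E) : 0 ≤ fderiv ℝ (fderiv ℝ g) x v v := by
  by_contra! hneg
  set c : ℝ → ℝ := fun t => g (x + t • v) with hc
  have htend : Tendsto (fun t : ℝ => x + t • v) (𝓝 0) (𝓝 x) := by
    have : Continuous fun t : ℝ => x + t • v := by fun_prop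
    simpa using this.tendsto 0
  have hdiff : ∀ᶠ y in 𝓝 x, DifferentiableAt ℝ g y :=
    (hg.eventually (by simp)).mono fun y hy => hy.differentiableAt (by simp)
  have hderiv : deriv c =ᶠ[𝓝 0] fun t => fderiv ℝ g (x + t • v) v := by
    filter_upwards [htend.eventually hdiff] with t ht
    exact ht.hasFDerivAt.hasDerivAt_comp_add_smul.deriv
  have hcmin : IsLocalMin c 0 := by
    have : ∀ᶠ t : ℝ in 𝓝 0, g x ≤ g (x + t • v) := htend.eventually h
    simpa [IsLocalMin, IsMinFilter, hc] using this
  have hd2 : DifferentiableAt ℝ (fderiv ℝ g) x :=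
    (hg.fderiv_right (m := 1) (by norm_num)).differentiableAt (by simp)
  have hd2c : deriv (deriv c) 0 = fderiv ℝ (fderiv ℝ g) x v v := by
    rw [hderiv.deriv_eq]
    have h1 : HasFDerivAt (fderiv ℝ g) (fderiv ℝ (fderiv ℝ g) x) (x + (0 : ℝ) • v) := by
      simpa using hd2.hasFDerivAt
    exact (h1.hasDerivAt_comp_add_smul.clm_apply (hasDerivAt_const (0 : ℝ) v)).deriv.trans
      (by simp)
  have hcont : ContinuousAt c 0 := by
    have h1 : HasFDerivAt g (fderiv ℝ g x) (x + (0 : ℝ) • v) := by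
      simpa using hdiff.self_of_nhds.hasFDerivAt
    exact h1.hasDerivAt_comp_add_smul.continuousAt
  -- A negative second derivative makes `0` a local maximum as well as a minimum, so `c` is constant
  -- nearby and its second derivative is `0`.
  have hcmax : IsLocalMax c 0 :=
    isLocalMax_of_deriv_deriv_neg (hd2c ▸ hneg) hcmin.deriv_eq_zero hcont
  have hconst : c =ᶠ[𝓝 0] fun _ => c 0 := by
    filter_upwards [hcmin, hcmax] with t h1 h2
    exact le_antisymm h2 h1
  have h0 : deriv (deriv c) 0 = 0 := by
    rw [hconst.deriv.deriv_eq]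
    simp
  linarith

/-- A positive semidefinite symmetric bilinear form with trivial kernel is positive definite. -/
theorem ContinuousLinearMap.apply_self_pos_of_nonneg_of_nonsingular {B : E →L[ℝ] E →L[ℝ] ℝ}
    (hsymm : ∀ v w, B v w = B w v) (hnonneg : ∀ v, 0 ≤ B v v)
    (hker : ∀ v, (∀ w, B v w = 0) → v = 0) {v : E} (hv : v ≠ 0) : 0 < B v v := by
  refine (hnonneg v).lt_of_ne' fun h0 => hv (hker v fun w => ?_)
  -- Cauchy–Schwarz for a semidefinite form: `B v v = 0` forces `B v w = 0` for every `w`.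
  have := LinearMap.BilinForm.apply_mul_apply_le_of_forall_zero_le
    B.toBilinForm hnonneg v w
  simp only [ContinuousLinearMap.toBilinForm_apply] at this
  rw [hsymm w v, h0, zero_mul] at this
  exact mul_self_eq_zero.1 (le_antisymm this (mul_self_nonneg _))

/-- A positive definite form on a finite-dimensional space is coercive. -/
theorem ContinuousLinearMap.exists_pos_forall_mul_norm_sq_le [FiniteDimensional ℝ E]
    {B : E →L[ℝ] E →L[ℝ] ℝ} (hpos : ∀ v, v ≠ 0 → 0 < B v v) :
    ∃ c > 0, ∀ v, c * ‖v‖ ^ 2 ≤ B v v := by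
  rcases subsingleton_or_nontrivial E with hE | hE
  · exact ⟨1, one_pos, fun v => by simp [Subsingleton.elim v 0]⟩
  have hne : (Metric.sphere (0 : E) 1).Nonempty := NormedSpace.sphere_nonempty.2 zero_le_one
  have hcont : Continuous fun v : E => B v v := by fun_prop
  -- The constant is the minimum of the quadratic form on the compact unit sphere; homogeneity
  -- extends the bound to all vectors.
  obtain ⟨u, hu, hmin⟩ := (isCompact_sphere (0 : E) 1).exists_isMinOn hne hcont.continuousOn
  have hu0 : u ≠ 0 := ne_zero_of_mem_unit_sphere ⟨u, hu⟩
  refine ⟨B u u, hpos u hu0, fun v => ?_⟩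
  rcases eq_or_ne v 0 with rfl | hv
  · simp
  have hv' : 0 < ‖v‖ := norm_pos_iff.2 hv
  have hmem : ‖v‖⁻¹ • v ∈ Metric.sphere (0 : E) 1 := by simp [norm_smul, hv'.ne']
  have h1 : B u u ≤ B (‖v‖⁻¹ • v) (‖v‖⁻¹ • v) := hmin hmem
  simp only [map_smul, smul_apply, smul_eq_mul] at h1
  calc B u u * ‖v‖ ^ 2 ≤ ‖v‖⁻¹ * (‖v‖⁻¹ * B v v) * ‖v‖ ^ 2 := by gcongr
    _ = B v v := by field_simp

/-- Positive definiteness is an open condition on bilinear forms. -/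
theorem ContinuousLinearMap.eventually_forall_apply_self_pos [FiniteDimensional ℝ E]
    {B : E →L[ℝ] E →L[ℝ] ℝ} (hpos : ∀ v, v ≠ 0 → 0 < B v v) :
    ∀ᶠ B' in 𝓝 B, ∀ v, v ≠ 0 → 0 < B' v v := by
  obtain ⟨c, hc, hB⟩ := exists_pos_forall_mul_norm_sq_le hpos
  filter_upwards [Metric.ball_mem_nhds B hc] with B' hB' v hv
  have h1 : ‖(B' - B) v v‖ ≤ ‖B' - B‖ * ‖v‖ * ‖v‖ := (B' - B).le_opNorm₂ v v
  have h2 : ‖B' - B‖ < c := (dist_eq_norm B' B).symm.trans_lt hB'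
  have hv' : 0 < ‖v‖ := norm_pos_iff.2 hv
  have h3 : ‖B' - B‖ * ‖v‖ * ‖v‖ < c * ‖v‖ * ‖v‖ := by gcongr
  have h4 := (abs_le.1 h1).1
  simp only [sub_apply] at h4
  linarith [hB v, sq ‖v‖, mul_assoc c ‖v‖ ‖v‖]

/-- Partial derivatives of a smooth function are jointly smooth. -/
theorem ContDiffAt.fderiv_partial_right {E' F : Type*} [NormedAddCommGroup E'] [NormedSpace ℝ E']
    [NormedAddCommGroup F] [NormedSpace ℝ F] {G : E → E' → F} {z₀ : E × E'}
    (hG : ContDiffAt ℝ ∞ (fun z : E × E' => G z.1 z.2) z₀) :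
    ContDiffAt ℝ ∞ (fun z : E × E' => fderiv ℝ (G z.1) z.2) z₀ := by
  -- Differentiating costs one order of smoothness, which is free at `∞`.
  refine ContDiffAt.fderiv (n := ∞) (f := fun z : E × E' => G z.1) (g := Prod.snd) ?_
    contDiffAt_snd (by simp)
  exact ContDiffAt.comp (f := fun w : (E × E') × E' => (w.1.1, w.2)) (z₀, z₀.2) hG (by fun_prop)

/-- Second-order sufficient condition for a local minimum. -/
theorem isLocalMin_of_fderiv_eq_zero_of_fderiv_fderiv_pos [FiniteDimensional ℝ E]
    {g : E → ℝ} {x : E} (hg : ContDiffAt ℝ 2 g x) (hcrit : fderiv ℝ g x = 0)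
    (hpos : ∀ v, v ≠ 0 → 0 < fderiv ℝ (fderiv ℝ g) x v v) : IsLocalMin g x := by
  obtain ⟨c, hc, hB⟩ := ContinuousLinearMap.exists_pos_forall_mul_norm_sq_le hpos
  set B := fderiv ℝ (fderiv ℝ g) x
  have hdiff : ∀ᶠ y in 𝓝 x, DifferentiableAt ℝ g y :=
    (hg.eventually (by simp)).mono fun y hy => hy.differentiableAt (by simp)
  have hd2 : HasFDerivAt (fderiv ℝ g) B x :=
    ((hg.fderiv_right (m := 1) (by norm_num)).differentiableAt (by simp)).hasFDerivAt
  -- The error constant is the coercivity constant itself: on the segment from `x` to `y`, with `w =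
  -- y - x`, the derivative of `g` is at least `t * B w w - c * t * ‖w‖ ^ 2 ≥ 0`, so `g` is monotone
  -- along it.
  have hsmall : ∀ᶠ y in 𝓝 x, ‖fderiv ℝ g y - B (y - x)‖ ≤ c * ‖y - x‖ := by
    filter_upwards [hd2.isLittleO.bound hc] with y hy
    simpa [hcrit] using hy
  obtain ⟨ε, hε, hball⟩ := Metric.eventually_nhds_iff_ball.1 (hdiff.and hsmall)
  filter_upwards [Metric.ball_mem_nhds x hε] with y hy
  have hin : ∀ t ∈ Set.Icc (0 : ℝ) 1, x + t • (y - x) ∈ Metric.ball x ε := fun t ht =>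
    (convex_ball x ε).add_smul_sub_mem (Metric.mem_ball_self hε) hy ht
  have hder : ∀ t ∈ Set.Icc (0 : ℝ) 1, HasDerivAt (fun s : ℝ => g (x + s • (y - x)))
      (fderiv ℝ g (x + t • (y - x)) (y - x)) t := fun t ht =>
    (hball _ (hin t ht)).1.hasFDerivAt.hasDerivAt_comp_add_smul
  have hmono : MonotoneOn (fun s : ℝ => g (x + s • (y - x))) (Set.Icc 0 1) := by
    refine monotoneOn_of_deriv_nonneg (convex_Icc 0 1)
      (fun t ht => (hder t ht).continuousAt.continuousWithinAt)
      (fun t ht => (hder t (interior_subset ht)).differentiableAt.differentiableWithinAt)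
      fun t ht => ?_
    have ht' := interior_subset ht
    rw [(hder t ht').deriv]
    have h1 := (hball _ (hin t ht')).2
    set w := y - x
    simp only [add_sub_cancel_left, map_smul, norm_smul, Real.norm_of_nonneg ht'.1] at h1
    have h2 : ‖(fderiv ℝ g (x + t • w) - t • B w) w‖ ≤ c * (t * ‖w‖) * ‖w‖ :=
      (ContinuousLinearMap.le_opNorm _ w).trans (by gcongr)
    have h3 := (abs_le.1 h2).1
    simp only [sub_apply, smul_apply, smul_eq_mul] at h3
    have h4 := mul_le_mul_of_nonneg_left (hB w) ht'.1
    linarith [show t * (c * ‖w‖ ^ 2) = c * (t * ‖w‖) * ‖w‖ by ring]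
  simpa using hmono (Set.left_mem_Icc.2 zero_le_one) (Set.right_mem_Icc.2 zero_le_one) zero_le_one

/-- At a non-degenerate critical point, being a local minimum means having a positive definite
Hessian. -/
theorem isLocalMin_iff_fderiv_fderiv_pos [FiniteDimensional ℝ E]
    {g : E → ℝ} {x : E} (hg : ContDiffAt ℝ 2 g x) (hcrit : fderiv ℝ g x = 0)
    (hker : ∀ v, (∀ w, fderiv ℝ (fderiv ℝ g) x v w = 0) → v = 0) :
    IsLocalMin g x ↔ ∀ v, v ≠ 0 → 0 < fderiv ℝ (fderiv ℝ g) x v v :=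
  ⟨fun h _ hv => ContinuousLinearMap.apply_self_pos_of_nonneg_of_nonsingular
      (hg.isSymmSndFDerivAt (by simp)) (h.fderiv_fderiv_apply_self_nonneg hg) hker hv,
    isLocalMin_of_fderiv_eq_zero_of_fderiv_fderiv_pos hg hcrit⟩

/-- A nonsingular symmetric form that is not positive definite has no positive definite forms
nearby. -/
theorem ContinuousLinearMap.eventually_not_forall_apply_self_pos {B : E →L[ℝ] E →L[ℝ] ℝ}
    (hsymm : ∀ v w, B v w = B w v) (hker : ∀ v, (∀ w, B v w = 0) → v = 0)
    (hB : ¬ ∀ v, v ≠ 0 → 0 < B v v) : ∀ᶠ B' in 𝓝 B, ¬ ∀ v, v ≠ 0 → 0 < B' v v := by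
  -- Without a negative value the form would be semidefinite and nonsingular, hence positive
  -- definite. Negativity at this fixed `v` is an open condition.
  obtain ⟨v, hv⟩ : ∃ v, B v v < 0 := by
    by_contra! h
    exact hB fun v hv => apply_self_pos_of_nonneg_of_nonsingular hsymm h hker hv
  have hcont : Continuous fun B' : E →L[ℝ] E →L[ℝ] ℝ => B' v v := by fun_prop
  filter_upwards [hcont.continuousAt.eventually_lt_const hv] with B' hB' h
  have hv0 : v ≠ 0 := by
    rintro rfl
    simp at hv
  exact (h v hv0).not_gt hB'

end SecondOrder

/-! ### Fibre charts and continuity of the fibre Hessian. -/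

namespace FibreOpt

open Filter

variable {EM HM M EΘ HΘ Θ EX HX X : Type*}
  [NormedAddCommGroup EM] [NormedSpace ℝ EM] [TopologicalSpace HM]
  [NormedAddCommGroup EΘ] [NormedSpace ℝ EΘ] [TopologicalSpace HΘ]
  [NormedAddCommGroup EX] [NormedSpace ℝ EX] [TopologicalSpace HX]
  {IM : ModelWithCorners ℝ EM HM}
  {IΘ : ModelWithCorners ℝ EΘ HΘ}
  {IX : ModelWithCorners ℝ EX HX}
  [TopologicalSpace M] [ChartedSpace HM M]
  [TopologicalSpace Θ] [ChartedSpace HΘ Θ]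
  [TopologicalSpace X] [ChartedSpace HX X]
  {π : M → Θ} {e : Bundle.Trivialization X π} {φ : OpenPartialHomeomorph X HX} {f : M → ℝ} {p : M}

/-- A fibre chart at `p` is a fibre chart at all nearby points. -/
theorem IsFibreChartAt.eventually (h : IsFibreChartAt IM IΘ IX e φ p) :
    ∀ᶠ q in 𝓝 p, IsFibreChartAt IM IΘ IX e φ q := by
  have hp : p ∈ e.source := e.mem_source.2 h.mem_baseSet
  have hsnd : ContinuousAt (fun q => (e q).2) p := (e.continuousAt hp).snd
  filter_upwards [e.open_source.mem_nhds hp, hsnd.preimage_mem_nhds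
    (φ.open_source.mem_nhds h.mem_source)] with q h1 h2
  exact ⟨h.smooth_triv, e.mem_source.1 h1, h.mem_atlas, h2⟩

theorem IsFibreChartAt.continuousAt_fibreCoord (h : IsFibreChartAt IM IΘ IX e φ p) :
    ContinuousAt (fibreCoord IX e φ) p :=
  ContinuousAt.comp (f := fun q => (e q).2) (φ.continuousAt_extend h.mem_source)
    (e.continuousAt (e.mem_source.2 h.mem_baseSet)).snd

theorem IsFibreChartAt.fibreCoord_mem_target (h : IsFibreChartAt IM IΘ IX e φ p) :
    fibreCoord IX e φ p ∈ (φ.extend IX).target :=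
  (φ.extend IX).map_source (by simpa using h.mem_source)

/-- The inverse fibre chart followed back to the total space. -/
theorem IsFibreChartAt.symm_fibreCoord (h : IsFibreChartAt IM IΘ IX e φ p) :
    e.toOpenPartialHomeomorph.symm (π p, (φ.extend IX).symm (fibreCoord IX e φ p)) = p := by
  rw [fibreCoord, φ.extend_left_inv h.mem_source]
  exact e.symm_apply_mk_proj (e.mem_source.2 h.mem_baseSet)

/-- Local minima of the restriction to a fibre can be detected in a fibre chart. -/
theorem IsFibreChartAt.isFibrewiseLocalMin_iff (h : IsFibreChartAt IM IΘ IX e φ p)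
    [IX.Boundaryless] :
    IsFibrewiseLocalMin π f p ↔ IsLocalMin (fibreRep IX e φ f (π p)) (fibreCoord IX e φ p) := by
  have hrep : fibreRep IX e φ f (π p) (fibreCoord IX e φ p) = f p := by
    rw [fibreRep, h.symm_fibreCoord]
  constructor
  · intro hmin
    have hcont : ContinuousAt (fun v => e.toOpenPartialHomeomorph.symm
        (π p, (φ.extend IX).symm v)) (fibreCoord IX e φ p) := by
      have h1 : ContinuousAt (fun v => (π p, (φ.extend IX).symm v)) (fibreCoord IX e φ p) :=
        continuousAt_const.prodMk (φ.continuousAt_extend_symm' h.fibreCoord_mem_target)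
      refine ContinuousAt.comp (g := e.toOpenPartialHomeomorph.symm) ?_ h1
      exact e.toOpenPartialHomeomorph.continuousAt_symm (e.mem_target.2 h.mem_baseSet)
    rw [ContinuousAt, h.symm_fibreCoord] at hcont
    -- The inverse fibre chart stays in the fibre, so minimality within the fibre suffices.
    have htend := tendsto_nhdsWithin_iff (s := π ⁻¹' {π p}).2 ⟨hcont, Eventually.of_forall fun v =>
      e.proj_symm_apply' h.mem_baseSet⟩
    filter_upwards [htend.eventually hmin] with v hv
    rw [hrep]
    exact hv
  · intro hmin
    have h1 := (h.continuousAt_fibreCoord (IX := IX)).eventually hmin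
    filter_upwards [nhdsWithin_le_nhds h1, nhdsWithin_le_nhds h.eventually, self_mem_nhdsWithin]
      with q hq hchart hfib
    rw [hrep, fibreRep, ← show π q = π p from hfib, hchart.symm_fibreCoord] at hq
    exact hq

/-- The coordinate representation of `f` is jointly smooth in the base and fibre coordinates. -/
theorem IsFibreChartAt.contDiffAt_uncurry_fibreRep [IΘ.Boundaryless] [IX.Boundaryless]
    [IsManifold IΘ ∞ Θ] (h : IsFibreChartAt IM IΘ IX e φ p)
    (hf : ContMDiff IM 𝓘(ℝ, ℝ) ∞ f) {θ₀ : Θ} (hθ₀ : π p ∈ (extChartAt IΘ θ₀).source) :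
    ContDiffAt ℝ ∞ (fun z : EΘ × EX => fibreRep IX e φ f ((extChartAt IΘ θ₀).symm z.1) z.2)
      (extChartAt IΘ θ₀ (π p), fibreCoord IX e φ p) := by
  rw [← contMDiffAt_iff_contDiffAt]
  set z₀ : EΘ × EX := (extChartAt IΘ θ₀ (π p), fibreCoord IX e φ p)
  have hΘ : ContMDiffAt 𝓘(ℝ, EΘ) IΘ ∞ (extChartAt IΘ θ₀).symm z₀.1 :=
    (contMDiffOn_extChartAt_symm θ₀).contMDiffAt
      ((isOpen_extChartAt_target θ₀).mem_nhds ((extChartAt IΘ θ₀).map_source hθ₀))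
  have hX : ContMDiffAt 𝓘(ℝ, EX) IX ∞ (φ.extend IX).symm z₀.2 := by
    refine (contMDiffOn_extend_symm h.mem_atlas).contMDiffAt ?_
    rw [← φ.extend_target']
    exact φ.isOpen_extend_target.mem_nhds h.fibreCoord_mem_target
  have hfst : ContMDiffAt 𝓘(ℝ, EΘ × EX) 𝓘(ℝ, EΘ) ∞ (fun z : EΘ × EX => z.1) z₀ :=
    contDiffAt_fst.contMDiffAt
  have hsnd : ContMDiffAt 𝓘(ℝ, EΘ × EX) 𝓘(ℝ, EX) ∞ (fun z : EΘ × EX => z.2) z₀ :=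
    contDiffAt_snd.contMDiffAt
  have hpair : ContMDiffAt 𝓘(ℝ, EΘ × EX) (IΘ.prod IX) ∞
      (fun z : EΘ × EX => ((extChartAt IΘ θ₀).symm z.1, (φ.extend IX).symm z.2)) z₀ :=
    (hΘ.comp z₀ hfst).prodMk (hX.comp z₀ hsnd)
  have he : ContMDiffAt (IΘ.prod IX) IM ∞ e.toOpenPartialHomeomorph.symm
      ((extChartAt IΘ θ₀).symm z₀.1, (φ.extend IX).symm z₀.2) := by
    refine h.smooth_triv.contMDiffOn_symm.contMDiffAt (e.open_target.mem_nhds (e.mem_target.2 ?_))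
    rw [(extChartAt IΘ θ₀).left_inv hθ₀]
    exact h.mem_baseSet
  exact (hf _).comp z₀ (he.comp z₀ hpair)

/-- Joint smoothness restricted to the slice with constant base coordinate. -/
theorem IsFibreChartAt.contDiffAt_fibreRep [IΘ.Boundaryless] [IX.Boundaryless]
    [IsManifold IΘ ∞ Θ] (h : IsFibreChartAt IM IΘ IX e φ p)
    (hf : ContMDiff IM 𝓘(ℝ, ℝ) ∞ f) :
    ContDiffAt ℝ ∞ (fibreRep IX e φ f (π p)) (fibreCoord IX e φ p) := by
  have h1 := h.contDiffAt_uncurry_fibreRep hf (mem_extChartAt_source (I := IΘ) (π p))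
  have h2 : ContDiffAt ℝ ∞ (fun v : EX => (extChartAt IΘ (π p) (π p), v)) (fibreCoord IX e φ p) :=
    contDiffAt_const.prodMk contDiffAt_id
  simpa [Function.comp_def] using
    ContDiffAt.comp (f := fun v : EX => (extChartAt IΘ (π p) (π p), v)) _ h1 h2

/-- In a fixed fibre chart, the Hessian depends continuously on the point. -/
theorem IsFibreChartAt.continuousAt_fibreHessian [IΘ.Boundaryless] [IX.Boundaryless]
    [IsManifold IΘ ∞ Θ] (h : IsFibreChartAt IM IΘ IX e φ p)
    (hf : ContMDiff IM 𝓘(ℝ, ℝ) ∞ f) : ContinuousAt (fibreHessian IX e φ f) p := by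
  set ψ := extChartAt IΘ (π p)
  set z₀ : EΘ × EX := (ψ (π p), fibreCoord IX e φ p)
  have hG : ContDiffAt ℝ ∞ (fun z : EΘ × EX => fibreRep IX e φ f (ψ.symm z.1) z.2) z₀ :=
    h.contDiffAt_uncurry_fibreRep hf (mem_extChartAt_source (π p))
  -- Two fibre derivatives, each jointly smooth in base and fibre coordinates.
  have h2 := (hG.fderiv_partial_right
    (G := fun t => fibreRep IX e φ f (ψ.symm t))).fderiv_partial_right
    (G := fun t v => fderiv ℝ (fibreRep IX e φ f (ψ.symm t)) v)
  have hbase : ContinuousAt π p := e.continuousAt_proj (e.mem_source.2 h.mem_baseSet)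
  have hψ : ContinuousAt (fun q => ψ (π q)) p :=
    ContinuousAt.comp (f := π) (continuousAt_extChartAt (π p)) hbase
  have h3 := ContinuousAt.comp (f := fun q => (ψ (π q), fibreCoord IX e φ q))
    h2.continuousAt (hψ.prodMk h.continuousAt_fibreCoord)
  refine h3.congr ?_
  -- The base chart cancels against its inverse only where `π q` lies in its source, which holds
  -- near `p`.
  filter_upwards [hbase.preimage_mem_nhds (extChartAt_source_mem_nhds (I := IΘ) (π p))] with q hq
  simp only [Function.comp_apply, fibreHessian]
  rw [ψ.left_inv hq]

/-- Every point of a smooth fibre bundle has a fibre chart. -/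
theorem IsSmoothFibreBundle.exists_isFibreChartAt [IsManifold IX ∞ X]
    (hπ : IsSmoothFibreBundle IM IΘ IX X π) (p : M) :
    ∃ (e : Bundle.Trivialization X π) (φ : OpenPartialHomeomorph X HX),
      IsFibreChartAt IM IΘ IX e φ p := by
  obtain ⟨e, he, hp⟩ := hπ (π p)
  exact ⟨e, chartAt HX (e p).2, he, hp, IsManifold.chart_mem_maximalAtlas _,
    mem_chart_source _ _⟩

/-! ### Local constancy on the critical set, and the conclusion. -/

/-- At a non-degenerate fibre-wise critical point, being a fibre-wise local minimum means having a
positive definite fibre Hessian. -/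
theorem IsFibreChartAt.isFibrewiseLocalMin_iff_fibreHessian_pos [FiniteDimensional ℝ EX]
    [IΘ.Boundaryless] [IX.Boundaryless] [IsManifold IΘ ∞ Θ] (h : IsFibreChartAt IM IΘ IX e φ p)
    (hf : ContMDiff IM 𝓘(ℝ, ℝ) ∞ f) (hcrit : IsFibrewiseCriticalPoint IM IΘ IX X π f p)
    (hns : FibrewiseHessianNonsingular IM IΘ IX X π f p) :
    IsFibrewiseLocalMin π f p ↔ ∀ v, v ≠ 0 → 0 < fibreHessian IX e φ f p v v :=
  h.isFibrewiseLocalMin_iff.trans <| isLocalMin_iff_fderiv_fderiv_pos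
    ((h.contDiffAt_fibreRep hf).of_le (WithTop.coe_le_coe.2 le_top)) (hcrit e φ h) (hns e φ h)

/-- For a fibre-wise Morse function, being a fibre-wise local minimum is locally constant on the
fibre-wise critical set. -/
theorem eventually_isFibrewiseLocalMin_iff [FiniteDimensional ℝ EX]
    [IΘ.Boundaryless] [IX.Boundaryless] [IsManifold IΘ ∞ Θ] [IsManifold IX ∞ X]
    (hπ : IsSmoothFibreBundle IM IΘ IX X π) (hf : ContMDiff IM 𝓘(ℝ, ℝ) ∞ f)
    (hMorse : IsFibrewiseMorse IM IΘ IX X π f) (hp : p ∈ fibrewiseCriticalSet IM IΘ IX X π f) :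
    ∀ᶠ q in 𝓝[fibrewiseCriticalSet IM IΘ IX X π f] p,
      (IsFibrewiseLocalMin π f q ↔ IsFibrewiseLocalMin π f p) := by
  obtain ⟨e, φ, h⟩ := hπ.exists_isFibreChartAt p
  have hH := h.continuousAt_fibreHessian hf
  have hpd : ∀ᶠ q in 𝓝 p, ((∀ v, v ≠ 0 → 0 < fibreHessian IX e φ f q v v) ↔
      ∀ v, v ≠ 0 → 0 < fibreHessian IX e φ f p v v) := by
    by_cases hpos : ∀ v, v ≠ 0 → 0 < fibreHessian IX e φ f p v v
    · filter_upwards [hH.eventually (ContinuousLinearMap.eventually_forall_apply_self_pos hpos)]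
        with q hq
      exact iff_of_true hq hpos
    · have hsymm : IsSymmSndFDerivAt ℝ (fibreRep IX e φ f (π p)) (fibreCoord IX e φ p) :=
        (h.contDiffAt_fibreRep hf).isSymmSndFDerivAt (by
          rw [minSmoothness_of_isRCLikeNormedField]; exact WithTop.coe_le_coe.2 le_top)
      filter_upwards [hH.eventually (ContinuousLinearMap.eventually_not_forall_apply_self_pos
        hsymm (hMorse p hp e φ h) hpos)] with q hq
      exact iff_of_false hq hpos
  -- Restricting to critical `q` lets the Hessian criterion apply at `q` in the same chart as at
  -- `p`.
  filter_upwards [nhdsWithin_le_nhds hpd, nhdsWithin_le_nhds h.eventually, self_mem_nhdsWithin]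
    with q hq hchart hqN
  rw [hchart.isFibrewiseLocalMin_iff_fibreHessian_pos hf hqN (hMorse q hqN), hq,
    h.isFibrewiseLocalMin_iff_fibreHessian_pos hf hp (hMorse p hp)]

end FibreOpt

theorem mainTheorem5
    {EM HM M EΘ HΘ Θ EX HX X : Type*}
    [NormedAddCommGroup EM] [NormedSpace ℝ EM] [FiniteDimensional ℝ EM] [TopologicalSpace HM]
    [NormedAddCommGroup EΘ] [NormedSpace ℝ EΘ] [FiniteDimensional ℝ EΘ] [TopologicalSpace HΘ]
    [NormedAddCommGroup EX] [NormedSpace ℝ EX] [FiniteDimensional ℝ EX] [TopologicalSpace HX]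
    (IM : ModelWithCorners ℝ EM HM) [IM.Boundaryless]
    (IΘ : ModelWithCorners ℝ EΘ HΘ) [IΘ.Boundaryless]
    (IX : ModelWithCorners ℝ EX HX) [IX.Boundaryless]
    [TopologicalSpace M] [ChartedSpace HM M] [IsManifold IM ∞ M] [T2Space M] [CompactSpace M]
    [TopologicalSpace Θ] [ChartedSpace HΘ Θ] [IsManifold IΘ ∞ Θ] [T2Space Θ] [CompactSpace Θ]
    [TopologicalSpace X] [ChartedSpace HX X] [IsManifold IX ∞ X] [T2Space X] [CompactSpace X]
    (π : M → Θ) (hπ : FibreOpt.IsSmoothFibreBundle IM IΘ IX X π)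
    (f : M → ℝ) (hf : ContMDiff IM 𝓘(ℝ, ℝ) ∞ f)
    (hMorse : FibreOpt.IsFibrewiseMorse IM IΘ IX X π f)
    (p q : M)
    (hp : p ∈ FibreOpt.fibrewiseCriticalSet IM IΘ IX X π f)
    (hq : q ∈ connectedComponentIn (FibreOpt.fibrewiseCriticalSet IM IΘ IX X π f) p) :
    FibreOpt.IsFibrewiseLocalMin π f p ↔ FibreOpt.IsFibrewiseLocalMin π f q := by
  classical
  -- `Bool` is discrete, so local constancy of `s` on the critical set is continuity there, and `s`
  -- is constant on a preconnected subset.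
  let s : M → Bool := fun x => decide (FibreOpt.IsFibrewiseLocalMin π f x)
  have hsub := connectedComponentIn_subset (FibreOpt.fibrewiseCriticalSet IM IΘ IX X π f) p
  have hs : ContinuousOn s (connectedComponentIn
      (FibreOpt.fibrewiseCriticalSet IM IΘ IX X π f) p) := by
    refine ContinuousOn.mono (fun x hx => ?_) hsub
    refine continuousWithinAt_const.congr_of_eventuallyEq (f := fun _ => s x) ?_ rfl
    filter_upwards [FibreOpt.eventually_isFibrewiseLocalMin_iff hπ hf hMorse hx] with y hy
    simp only [s, hy]
  have := isPreconnected_connectedComponentIn.constant hs (mem_connectedComponentIn hp) hq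
  simpa [s] using this
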